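/- Let $p$ be a prime, let $m,n,s\ge 1$ be integers, let $\mathcal R=\mathbb F_{p^m}[u]/\langle u^3\rangle$, and let $\alpha_0\in\mathbb F_{p^m}\setminus\{0\}$ be such that $f=x^n-\alpha_0$ is irreducible over $\mathbb F_{p^m}$. Put $\alpha=\alpha_0^{p^s}$ and $\mathcal R_\alpha=\mathcal R[x]/\langle x^{np^s}-\alpha\rangle$. An $\alpha$-constacyclic code of length $np^s$ over $\mathcal R$ is an ideal $\mathcal C$ of $\mathcal R_\alpha$, identified with an $\mathcal R$-submodule of $\mathcal R^{np^s}$ through $(a_0,\dots,a_{np^s-1})\mapsto\sum_i a_ix^i$. Let $\mathcal C^\perp$ be its dual with respect to $v\cdot c=\sum_i v_ic_i$. The code $\mathcal C$ is isodual if $\mathcal C$ and $\mathcal C^\perp$ are $\mathcal R$-linearly equivalent. The results below hold both when this means that some monomial transformation of $\mathcal R^{np^s}$ (a permutation of the coordinates together with multiplications of the coordinates by units of $\mathcal R$) maps $\mathcal C$ onto $\mathcal C^\perp$, and when it means that $\mathcal C$ and $\mathcal C^\perp$ are isomorphic $\mathcal R$-modules. For an ideal $\mathcal C$ of $\mathcal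 R_\alpha$, let $\mathrm{Res}_u(\mathcal C)$, $\mathrm{Tor}_u(\mathcal C)$ and $\mathrm{Tor}_{u^2}(\mathcal C)$ be the ideals of $\mathbb F_{p^m}[x]/\langle f^{p^s}\rangle$ consisting, respectively, of the $a_0$ with $a_0+ua_1+u^2a_2\in\mathcal C$ for some $a_1,a_2$; of the $a_1$ with $ua_1+u^2a_2\in\mathcal C$ for some $a_2$; and of the $a_2$ with $u^2a_2\in\mathcal C$. They are $\langle f^a\rangle$, $\langle f^b\rangle$ and $\langle f^c\rangle$ with $0\le c\le b\le a\le p^s$. A code $\mathcal C\ne\{0\},\mathcal R_\alpha$ is of Type I if $a=b=p^s$, of Type II if $a=p^s$ and $b<p^s$, and of Type III if $a<p^s$. Then: (a) There is no isodual $\alpha$-constacyclic code of Type I over $\mathcal R$. (b) There is an isodual $\alpha$-constacyclic code of Type II over $\mathcal R$ if and only if $p=2$. When $p=2$, the code $\langle uf^{2^{s-1}},u^2\rangle$ is the only isodual $\alpha$-constacyclic code of Type II over $\mathcal R$. (c) There is an isodual $\alpha$-constacyclic code of Type III over $\mathcal R$ if and only if $p=2$. When $p=2$, for each integer $a$ with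 $2^{s-1}\le a<2^s$, the codes $$\mathcal C=\langle f^a+u^2f^{t_2}D_2(x),\;uf^{2^{s-1}},\;u^2f^{2^s-a}\rangle$$ are isodual $\alpha$-constacyclic codes of Type III over $\mathcal R$, and each of them equals its own annihilator in $\mathcal R_\alpha$. Here either $D_2(x)=0$, or $0\le t_2<2^s-a$ and $D_2(x)$ is a unit of $\mathcal R_\alpha$ of the form $\sum_{\ell=0}^{2^s-a-t_2-1}Q_\ell(x)f^\ell$, where each $Q_\ell(x)\in\mathbb F_{p^m}[x]$ is zero or of degree less than $n$. -/

import Mathlib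

open Polynomial

noncomputable section

namespace U3Code

/-- The chain ring `F[u]/⟨u³⟩`. -/
abbrev ChainRing (F : Type*) [Field F] : Type _ := AdjoinRoot (X ^ 3 : F[X])

/-- The ring `R[x]/⟨x^N - lam⟩` with `R = F[u]/⟨u³⟩`. Its ideals are the `lam`-constacyclic codes
of length `N` over `R`. -/
abbrev ConstaRing (F : Type*) [Field F] (N : ℕ) (lam : ChainRing F) : Type _ :=
  AdjoinRoot (X ^ N - C lam : (ChainRing F)[X])

/-- The standard `R`-linear map `R^N → R[x]/⟨x^N - lam⟩`,
`(a_0, …, a_{N-1}) ↦ a_0 + a_1 x + ⋯ + a_{N-1} x^{N-1}`. -/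
def ofWord {F : Type*} [Field F] (N : ℕ) (lam : ChainRing F) :
    (Fin N → ChainRing F) →ₗ[ChainRing F] ConstaRing F N lam :=
  Fintype.linearCombination (ChainRing F) (fun i : Fin N =>
    (AdjoinRoot.root (X ^ N - C lam : (ChainRing F)[X])) ^ (i : ℕ))

/-- The set of words in `R^N` of the constacyclic code given by an ideal. -/
def words {F : Type*} [Field F] {N : ℕ} {lam : ChainRing F} (I : Ideal (ConstaRing F N lam)) :
    Submodule (ChainRing F) (Fin N → ChainRing F) :=
  (I.restrictScalars (ChainRing F)).comap (ofWord N lam)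

/-- The Euclidean dual of a linear code. -/
def dualCode {R : Type*} [CommRing R] {N : ℕ} (D : Submodule R (Fin N → R)) :
    Submodule R (Fin N → R) where
  carrier := {v | ∀ c ∈ D, ∑ i, v i * c i = 0}
  zero_mem' := fun c _ => by simp
  add_mem' := fun {v w} hv hw c hc => by
    simp [add_mul, Finset.sum_add_distrib, hv c hc, hw c hc]
  smul_mem' := fun r v hv c hc => by
    simp [mul_assoc, ← Finset.mul_sum, hv c hc]

/-- Linear equivalence of codes through a monomial transformation of `R^N`: a permutation of the
coordinates together with a multiplication of each coordinate by a unit. -/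
def MonomiallyEquivalent {R : Type*} [CommRing R] {N : ℕ} (D E : Submodule R (Fin N → R)) : Prop :=
  ∃ (σ : Equiv.Perm (Fin N)) (d : Fin N → Rˣ),
    (E : Set (Fin N → R)) = (fun c i => (d i : R) * c (σ i)) '' (D : Set (Fin N → R))

/-- Linear equivalence of codes as abstract `R`-modules. -/
def LinearlyIsomorphic {R : Type*} [CommRing R] {N : ℕ} (D E : Submodule R (Fin N → R)) : Prop :=
  Nonempty (D ≃ₗ[R] E)

/-- A constacyclic code is isodual, with respect to the notion `Eqv` of linear equivalence, if it
is equivalent to its dual code. -/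
def IsIsodual {F : Type*} [Field F]  {N : ℕ} {lam : ChainRing F}
    (Eqv : Submodule (ChainRing F) (Fin N → ChainRing F) →
      Submodule (ChainRing F) (Fin N → ChainRing F) → Prop)
    (I : Ideal (ConstaRing F N lam)) : Prop :=
  Eqv (words I) (dualCode (words I))

/-- The element `u` of `R[x]/⟨x^N - lam⟩`. -/
def uu {F : Type*} [Field F] (N : ℕ) (lam : ChainRing F) : ConstaRing F N lam :=
  AdjoinRoot.of _ (AdjoinRoot.root (X ^ 3 : F[X]))

/-- The class in `R[x]/⟨x^N - lam⟩` of a polynomial with coefficients in `F`. -/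
def cls {F : Type*} [Field F] (N : ℕ) (lam : ChainRing F) : F[X] →ₐ[F] ConstaRing F N lam :=
  aeval (AdjoinRoot.root (X ^ N - C lam : (ChainRing F)[X]))

/-- `x^n - α₀`. -/
abbrev binom {F : Type*} [Field F] (n : ℕ) (α₀ : F) : F[X] := X ^ n - C α₀

/-- `α = α₀^q`, as an element of `F[u]/⟨u³⟩`. -/
abbrev alpha {F : Type*} [Field F] (q : ℕ) (α₀ : F) : ChainRing F :=
  algebraMap F (ChainRing F) (α₀ ^ q)

section Types

variable {F : Type*} [Field F] {n q : ℕ} {α₀ : F}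

/-- `Res_u(I)`, a subset of `F[x]/⟨(x^n - α₀)^q⟩`. -/
def resU (I : Ideal (ConstaRing F (n * q) (alpha q α₀))) : Set (AdjoinRoot (binom n α₀ ^ q)) :=
  {z | ∃ a₀ a₁ a₂ : F[X], z = AdjoinRoot.mk _ a₀ ∧
    cls _ _ a₀ + uu _ _ * cls _ _ a₁ + uu _ _ ^ 2 * cls _ _ a₂ ∈ I}

/-- `Tor_u(I)`. -/
def torU (I : Ideal (ConstaRing F (n * q) (alpha q α₀))) : Set (AdjoinRoot (binom n α₀ ^ q)) :=
  {z | ∃ a₁ a₂ : F[X], z = AdjoinRoot.mk _ a₁ ∧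
    uu _ _ * cls _ _ a₁ + uu _ _ ^ 2 * cls _ _ a₂ ∈ I}

/-- `Tor_{u²}(I)`. -/
def torU2 (I : Ideal (ConstaRing F (n * q) (alpha q α₀))) : Set (AdjoinRoot (binom n α₀ ^ q)) :=
  {z | ∃ a₂ : F[X], z = AdjoinRoot.mk _ a₂ ∧ uu _ _ ^ 2 * cls _ _ a₂ ∈ I}

/-- The ideal `⟨(x^n - α₀)^i⟩` of `F[x]/⟨(x^n - α₀)^q⟩`. -/
def powIdeal (n q : ℕ) (α₀ : F) (i : ℕ) : Ideal (AdjoinRoot (binom n α₀ ^ q)) :=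
  Ideal.span {AdjoinRoot.mk _ (binom n α₀ ^ i)}

/-- `I` is a non-trivial ideal with `Res_u(I) = ⟨f^a⟩`, `Tor_u(I) = ⟨f^b⟩`, `Tor_{u²}(I) = ⟨f^c⟩`,
where `f = x^n - α₀` and `0 ≤ c ≤ b ≤ a ≤ q`. -/
def HasExponents (I : Ideal (ConstaRing F (n * q) (alpha q α₀))) (a b c : ℕ) : Prop :=
  I ≠ ⊥ ∧ I ≠ ⊤ ∧ c ≤ b ∧ b ≤ a ∧ a ≤ q ∧
    resU I = powIdeal n q α₀ a ∧ torU I = powIdeal n q α₀ b ∧ torU2 I = powIdeal n q α₀ c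

def IsTypeI (I : Ideal (ConstaRing F (n * q) (alpha q α₀))) : Prop :=
  ∃ c, HasExponents I q q c

def IsTypeII (I : Ideal (ConstaRing F (n * q) (alpha q α₀))) : Prop :=
  ∃ b c, b < q ∧ HasExponents I q b c

def IsTypeIII (I : Ideal (ConstaRing F (n * q) (alpha q α₀))) : Prop :=
  ∃ a b c, a < q ∧ HasExponents I a b c

end Types

end U3Code

end

open U3Code

/-! Write `q = p^s` and `A = F[x]/⟨f^q⟩`. By Frobenius `x^(nq) - α = f^q`, so the constacyclic ring
is `A ⊕ uA ⊕ u²A`, and the pairing "coefficient of `x^(nq-1)` in the product" identifies the dual of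
a code with the coordinate reversal of its annihilator (`mem_dualCode_words`). An isodual code is
therefore isomorphic, as an `R`-module, to its annihilator.

Two numerical invariants then decide everything (`HasExponents.add_eq_of_isomorphic`). A code with
exponents `a, b, c` has dimension `n(3q - a - b - c)` over `F`, and the dimensions of an ideal and
its annihilator add up to `3nq`; hence `2(a+b+c) = 3q`. The elements killed by `u` have dimension
`n(q - c)` in the code and `na` in the annihilator, whose last torsion exponent is `q - a`; hence `a
+ c = q`. Together `2b = q`, which excludes `b = q` and forces `p = 2`.

Conversely, in characteristic 2 the displayed ideals equal their own annihilator
(`annihilator_eq_and_hasExponents`), and reversal is then a monomial equivalence with the dual. Type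
II is the boundary case `a = q`, `c = 0`, where the exponents determine the ideal
(`HasExponents.eq_span`). -/

namespace U3Code

/-! ### The top coefficient functional on `R[x]/⟨g⟩`. -/

section TopCoeff

variable {R : Type*} [CommRing R]

/-- The coefficient of `x^(d-1)` in an element of `R[x]/⟨g⟩`, where `g` is monic of degree `d`. -/
noncomputable def topCoeff {g : R[X]} (hg : g.Monic) : AdjoinRoot g →ₗ[R] R :=
  lcoeff R (g.natDegree - 1) ∘ₗ AdjoinRoot.modByMonicHom hg

theorem topCoeff_mk {g : R[X]} (hg : g.Monic) (p : R[X]) :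
    topCoeff hg (AdjoinRoot.mk g p) = (p %ₘ g).coeff (g.natDegree - 1) := by
  simp [topCoeff]

/-- A power of `x` shifts the leading term of the reduced representative to degree `d - 1` without
any reduction. This is the nondegeneracy of the trace-like form, over any nontrivial commutative
ring. -/
theorem exists_topCoeff_ne_zero [Nontrivial R] {g : R[X]} (hg : g.Monic) {w : AdjoinRoot g}
    (hw : w ≠ 0) : ∃ i : ℕ, topCoeff hg (AdjoinRoot.root g ^ i * w) ≠ 0 := by
  obtain ⟨p₀, rfl⟩ := AdjoinRoot.mk_surjective w
  have hdeg := degree_modByMonic_lt p₀ hg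
  have hmk : AdjoinRoot.mk g (p₀ %ₘ g) = AdjoinRoot.mk g p₀ := by
    rw [AdjoinRoot.mk_eq_mk, modByMonic_eq_sub_mul_div]
    exact ⟨-(p₀ /ₘ g), by ring⟩
  rw [← hmk] at hw ⊢
  generalize p₀ %ₘ g = p at *
  have hp : p ≠ 0 := by rintro rfl; simp at hw
  have hlt : p.natDegree < g.natDegree := natDegree_lt_natDegree hp hdeg
  refine ⟨g.natDegree - 1 - p.natDegree, ?_⟩
  rw [← AdjoinRoot.mk_X, ← map_pow, ← map_mul, topCoeff_mk, (modByMonic_eq_self_iff hg).2]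
  · obtain ⟨k, hk⟩ := Nat.exists_eq_add_of_lt hlt
    rw [show g.natDegree - 1 - p.natDegree = k by omega,
      show g.natDegree - 1 = p.natDegree + k by omega, coeff_X_pow_mul]
    simpa using hp
  · rw [degree_eq_natDegree hg.ne_zero, degree_lt_iff_coeff_zero]
    intro m hm
    rw [coeff_X_pow_mul']
    split_ifs
    · exact coeff_eq_zero_of_natDegree_lt (by omega)
    · rfl

/-- The bound covers all products of two basis monomials. Past `x^N = lam`, the reduced exponent `k
- N` stays below `N - 1`, so wrapping around never contributes. -/
theorem topCoeff_root_pow [Nontrivial R] {N : ℕ} (hN : N ≠ 0) (lam : R) {k : ℕ}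
    (hk : k + 1 < 2 * N) :
    topCoeff (monic_X_pow_sub_C lam hN) (AdjoinRoot.root (X ^ N - C lam) ^ k) =
      if k + 1 = N then 1 else 0 := by
  have hdeg : (X ^ N - C lam : R[X]).natDegree = N := natDegree_X_pow_sub_C
  have key : ∀ j < N, topCoeff (monic_X_pow_sub_C lam hN)
      (AdjoinRoot.root (X ^ N - C lam) ^ j) = if j + 1 = N then 1 else 0 := by
    intro j hj
    rw [← AdjoinRoot.mk_X, ← map_pow, topCoeff_mk, (modByMonic_eq_self_iff
      (monic_X_pow_sub_C lam hN)).2, hdeg, coeff_X_pow]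
    · congr 1
      simp only [eq_iff_iff]
      omega
    · rw [degree_X_pow_sub_C (Nat.pos_of_ne_zero hN), degree_X_pow]
      exact_mod_cast hj
  rcases lt_or_ge k N with h | h
  · exact key k h
  · obtain ⟨j, rfl⟩ := Nat.exists_eq_add_of_le h
    have hroot : AdjoinRoot.root (X ^ N - C lam) ^ N = AdjoinRoot.of (X ^ N - C lam) lam := by
      have := AdjoinRoot.mk_self (f := X ^ N - C lam)
      rwa [map_sub, map_pow, AdjoinRoot.mk_X, AdjoinRoot.mk_C, sub_eq_zero] at this
    rw [pow_add, hroot, ← AdjoinRoot.algebraMap_eq, ← Algebra.smul_def, map_smul,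
      key j (by omega), if_neg (by omega), if_neg (by omega), smul_zero]

end TopCoeff

/-! ### Dimension of a subspace of a product. -/

section Dim

open Module

variable {k V W : Type*} [Field k] [AddCommGroup V] [Module k V] [FiniteDimensional k V]
  [AddCommGroup W] [Module k W] [FiniteDimensional k W]

theorem finrank_submodule_prod (T : Submodule k (V × W)) :
    finrank k T = finrank k (T.map (LinearMap.fst k V W)) +
      finrank k (T.comap (LinearMap.inr k V W)) := by
  have h := LinearMap.finrank_range_add_finrank_ker ((LinearMap.fst k V W).domRestrict T)
  rw [LinearMap.range_domRestrict] at h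
  rw [← h]
  congr 1
  have h0 : ∀ y : LinearMap.ker ((LinearMap.fst k V W).domRestrict T), y.1.1.1 = 0 := fun y => y.2
  let e : LinearMap.ker ((LinearMap.fst k V W).domRestrict T) ≃ₗ[k]
      T.comap (LinearMap.inr k V W) :=
    { toFun := fun y => ⟨y.1.1.2, by
        have hy : (0, y.1.1.2) = y.1.1 := Prod.ext (h0 y).symm rfl
        change (0, y.1.1.2) ∈ T
        rw [hy]
        exact y.1.2⟩
      invFun := fun x => ⟨⟨(0, x.1), x.2⟩, rfl⟩
      map_add' := fun _ _ => rfl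
      map_smul' := fun _ _ => rfl
      left_inv := fun y => Subtype.ext (Subtype.ext (Prod.ext (h0 y).symm rfl))
      right_inv := fun _ => rfl }
  exact e.finrank_eq

end Dim

/-! ### Monomial equivalence implies module isomorphism. -/

section MonomialIso

variable {R : Type*} [CommRing R] {N : ℕ}

theorem MonomiallyEquivalent.linearlyIsomorphic {D E : Submodule R (Fin N → R)}
    (h : MonomiallyEquivalent D E) : LinearlyIsomorphic D E := by
  obtain ⟨σ, d, h⟩ := h
  let e : (Fin N → R) ≃ₗ[R] (Fin N → R) :=
    (LinearEquiv.funCongrLeft R R σ).trans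
      (LinearEquiv.piCongrRight fun i => LinearEquiv.smulOfUnit (d i))
  have hE : D.map (e : (Fin N → R) →ₗ[R] (Fin N → R)) = E := by
    apply SetLike.coe_injective
    rw [h]
    rfl
  exact ⟨(e.submoduleMap D).trans (LinearEquiv.ofEq _ _ hE)⟩

theorem isomorphic_of_eqv {F : Type*} [Field F] {lam : ChainRing F}
    {Eqv : Submodule (ChainRing F) (Fin N → ChainRing F) →
      Submodule (ChainRing F) (Fin N → ChainRing F) → Prop}
    (hEqv : Eqv = MonomiallyEquivalent ∨ Eqv = LinearlyIsomorphic)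
    {I : Ideal (ConstaRing F N lam)} (h : IsIsodual Eqv I) :
    LinearlyIsomorphic (words I) (dualCode (words I)) := by
  rcases hEqv with rfl | rfl
  · exact h.linearlyIsomorphic
  · exact h

end MonomialIso

/-! ### Dual codes as reversed annihilators, and their dimensions. -/

section Words

variable {F : Type*} [Field F] {N : ℕ} {lam : ChainRing F}

theorem natDegree_X_cube : (X ^ 3 : F[X]).natDegree = 3 := natDegree_X_pow 3

instance : Nontrivial (ChainRing F) :=
  (AdjoinRoot.coe_injective (f := (X ^ 3 : F[X])) (by rw [degree_X_pow]; decide)).nontrivial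

theorem ofWord_apply (v : Fin N → ChainRing F) :
    ofWord N lam v = ∑ i, v i • AdjoinRoot.root (X ^ N - C lam) ^ (i : ℕ) := rfl

theorem ofWord_bijective (hN : N ≠ 0) : Function.Bijective (ofWord N lam) := by
  have hg := monic_X_pow_sub_C lam hN
  have hdeg : (X ^ N - C lam : (ChainRing F)[X]).natDegree = N := natDegree_X_pow_sub_C
  let b := (AdjoinRoot.powerBasis' hg).basis.reindex (finCongr hdeg)
  have : ofWord N lam = b.equivFun.symm := by
    ext i
    simp [b, ofWord, Fintype.linearCombination_apply_single, Pi.single_apply]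
    rfl
  rw [this]
  exact b.equivFun.symm.bijective

/-- `R^N → R[x]/⟨x^N - lam⟩` as an equivalence. -/
noncomputable def wordEquiv (hN : N ≠ 0) (lam : ChainRing F) :
    (Fin N → ChainRing F) ≃ₗ[ChainRing F] ConstaRing F N lam :=
  LinearEquiv.ofBijective (ofWord N lam) (ofWord_bijective hN)

theorem topCoeff_ofWord_mul (hN : N ≠ 0) (v c : Fin N → ChainRing F) :
    topCoeff (monic_X_pow_sub_C lam hN) (ofWord N lam v * ofWord N lam c) =
      ∑ i, v i.rev * c i := by
  simp only [ofWord_apply, Finset.sum_mul_sum, map_sum, smul_mul_smul_comm, map_smul, ← pow_add]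
  rw [Finset.sum_comm]
  refine Finset.sum_congr rfl fun j _ => ?_
  rw [Finset.sum_eq_single j.rev]
  · rw [topCoeff_root_pow hN lam (by have := j.2; rw [Fin.val_rev]; omega), if_pos, smul_eq_mul,
      mul_one]
    rw [Fin.val_rev]; omega
  · intro i _ hi
    rw [topCoeff_root_pow hN lam (by omega), if_neg, smul_zero]
    intro h
    apply hi
    ext
    rw [Fin.val_rev]
    omega
  · simp

/-- The dot product is the top coefficient of the product with the reversed word. If that product
with some `a ∈ I` were nonzero, a shift `x^i a`, still in `I`, would give a nonzero dot product. -/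
theorem mem_dualCode_words (hN : N ≠ 0) (I : Ideal (ConstaRing F N lam))
    (v : Fin N → ChainRing F) :
    v ∈ dualCode (words I) ↔ v ∘ Fin.rev ∈ words I.annihilator := by
  have hg := monic_X_pow_sub_C lam hN
  have key : ∀ c, topCoeff (monic_X_pow_sub_C lam hN)
      (ofWord N lam (v ∘ Fin.rev) * ofWord N lam c) = ∑ i, v i * c i := by
    intro c
    rw [topCoeff_ofWord_mul hN]
    simp
  constructor
  · intro hv
    change ofWord N lam (v ∘ Fin.rev) ∈ I.annihilator
    rw [Submodule.mem_annihilator]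
    intro a ha
    by_contra hne
    obtain ⟨i, hi⟩ := exists_topCoeff_ne_zero hg hne
    obtain ⟨c, hc⟩ := (ofWord_bijective (lam := lam) hN).2 (AdjoinRoot.root _ ^ i * a)
    apply hi
    rw [smul_eq_mul, mul_left_comm, ← hc, key]
    refine hv c ?_
    change ofWord N lam c ∈ I
    rw [hc]
    exact I.mul_mem_left _ ha
  · intro hv c hc
    change ofWord N lam (v ∘ Fin.rev) ∈ I.annihilator at hv
    rw [Submodule.mem_annihilator] at hv
    rw [← key, ← smul_eq_mul, hv _ hc, map_zero]

theorem isIsodual_of_annihilator_eq (hN : N ≠ 0)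
    {Eqv : Submodule (ChainRing F) (Fin N → ChainRing F) →
      Submodule (ChainRing F) (Fin N → ChainRing F) → Prop}
    (hEqv : Eqv = MonomiallyEquivalent ∨ Eqv = LinearlyIsomorphic)
    {I : Ideal (ConstaRing F N lam)} (hI : I.annihilator = I) : IsIsodual Eqv I := by
  have h : MonomiallyEquivalent (words I) (dualCode (words I)) := by
    refine ⟨Fin.revPerm, 1, ?_⟩
    ext v
    simp only [SetLike.mem_coe, mem_dualCode_words hN, hI, Set.mem_image]
    constructor
    · intro hv
      exact ⟨_, hv, by ext i; simp⟩
    · rintro ⟨c, hc, rfl⟩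
      convert hc
      ext i
      simp
  rcases hEqv with rfl | rfl
  · exact h
  · exact h.linearlyIsomorphic

/-- The words of a code are isomorphic to the code. -/
noncomputable def wordsEquiv (hN : N ≠ 0) (I : Ideal (ConstaRing F N lam)) :
    words I ≃ₗ[ChainRing F] I.restrictScalars (ChainRing F) :=
  (wordEquiv hN lam).ofSubmodule' (I.restrictScalars (ChainRing F))

theorem nonempty_dualCode_equiv (hN : N ≠ 0) (I : Ideal (ConstaRing F N lam)) :
    Nonempty (dualCode (words I) ≃ₗ[ChainRing F] words I.annihilator) := by
  have h : (words I.annihilator).comap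
      (LinearEquiv.funCongrLeft (ChainRing F) (ChainRing F) Fin.revPerm).toLinearMap =
      dualCode (words I) := by
    ext v
    rw [mem_dualCode_words hN]
    rfl
  rw [← h]
  exact ⟨LinearEquiv.ofSubmodule' _ _⟩

theorem nonempty_equiv_annihilator (hN : N ≠ 0) {I : Ideal (ConstaRing F N lam)}
    (h : LinearlyIsomorphic (words I) (dualCode (words I))) :
    Nonempty (I.restrictScalars (ChainRing F) ≃ₗ[ChainRing F]
      I.annihilator.restrictScalars (ChainRing F)) := by
  obtain ⟨e⟩ := h
  obtain ⟨e'⟩ := nonempty_dualCode_equiv hN I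
  exact ⟨(wordsEquiv hN I).symm.trans (e.trans (e'.trans (wordsEquiv hN I.annihilator)))⟩

theorem finrank_constaRing (hN : N ≠ 0) : Module.finrank F (ConstaRing F N lam) = 3 * N := by
  have h3 := (monic_X_pow 3 : (X ^ 3 : F[X]).Monic)
  have hg := monic_X_pow_sub_C lam hN
  have hdeg : (X ^ N - C lam : (ChainRing F)[X]).natDegree = N := natDegree_X_pow_sub_C
  have := h3.free_adjoinRoot
  have := hg.free_adjoinRoot
  rw [← Module.finrank_mul_finrank F (ChainRing F) (ConstaRing F N lam),
    (AdjoinRoot.powerBasis' hg).finrank, (AdjoinRoot.powerBasis' h3).finrank,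
    AdjoinRoot.powerBasis'_dim, AdjoinRoot.powerBasis'_dim, hdeg, natDegree_X_cube]

theorem finite_constaRing (hN : N ≠ 0) : Module.Finite F (ConstaRing F N lam) := by
  have := (monic_X_pow 3 : (X ^ 3 : F[X]).Monic).finite_adjoinRoot
  have := (monic_X_pow_sub_C lam hN).finite_adjoinRoot
  exact Module.Finite.trans (ChainRing F) _

/-- Taking top coefficients in `x` and then in `u` gives a functional `T` for which `(v, w) ↦ T(vw)`
is nondegenerate; the orthogonal complement of an ideal under this form is its annihilator. -/
theorem finrank_add_finrank_annihilator (hN : N ≠ 0) (I : Ideal (ConstaRing F N lam)) :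
    Module.finrank F (I.restrictScalars F) + Module.finrank F (I.annihilator.restrictScalars F) =
      3 * N := by
  have := finite_constaRing (F := F) (lam := lam) hN
  have h3 := (monic_X_pow 3 : (X ^ 3 : F[X]).Monic)
  have hg := monic_X_pow_sub_C lam hN
  let T : ConstaRing F N lam →ₗ[F] F := topCoeff h3 ∘ₗ (topCoeff hg).restrictScalars F
  have hT : ∀ w ≠ 0, ∃ r, T (r * w) ≠ 0 := by
    intro w hw
    obtain ⟨i, hi⟩ := exists_topCoeff_ne_zero hg hw
    obtain ⟨j, hj⟩ := exists_topCoeff_ne_zero h3 hi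
    refine ⟨(AdjoinRoot.root (X ^ 3 : F[X]) ^ j) • AdjoinRoot.root _ ^ i, ?_⟩
    simpa [T, smul_mul_assoc] using hj
  let B : LinearMap.BilinForm F (ConstaRing F N lam) := (LinearMap.mul F _).compr₂ T
  have hB : ∀ v w, B v w = T (v * w) := fun v w => rfl
  have hs : B.IsSymm := ⟨fun v w => by simp [hB, mul_comm]⟩
  have hnd : B.Nondegenerate := by
    refine (LinearMap.IsRefl.nondegenerate_iff_separatingLeft hs.isRefl).2 ?_
    intro w hw
    by_contra hne
    obtain ⟨r, hr⟩ := hT w hne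
    exact hr (by rw [mul_comm, ← hB, hw])
  have horth : B.orthogonal (I.restrictScalars F) = I.annihilator.restrictScalars F := by
    ext v
    simp only [LinearMap.BilinForm.mem_orthogonal_iff, Submodule.restrictScalars_mem,
      Submodule.mem_annihilator, smul_eq_mul]
    constructor
    · intro h a ha
      by_contra hne
      obtain ⟨r, hr⟩ := hT _ hne
      exact hr (by
        have := h (r * a) (I.mul_mem_left r ha)
        change B (r * a) v = 0 at this
        rwa [hB, mul_assoc, mul_comm a] at this)
    · intro h a ha
      change B a v = 0
      rw [hB, mul_comm, h a ha, map_zero]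
  have h := LinearMap.BilinForm.finrank_orthogonal hnd (I.restrictScalars F)
  rw [horth, finrank_constaRing hN] at h
  have hle := Submodule.finrank_le (I.restrictScalars F)
  rw [finrank_constaRing hN] at hle
  omega

end Words

/-! ### Coordinates on `1, u, u²` and the dimension of a code. -/

section Coordinates

variable {F : Type*} [Field F] {n q : ℕ} {α₀ : F}

theorem uu_pow_three (N : ℕ) (lam : ChainRing F) : uu N lam ^ 3 = 0 := by
  have := AdjoinRoot.mk_self (f := (X ^ 3 : F[X]))
  rw [map_pow, AdjoinRoot.mk_X] at this
  rw [uu, ← map_pow, this, map_zero]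

theorem cls_X_pow_sub_C (N : ℕ) (c : F) :
    cls N (algebraMap F (ChainRing F) c) (X ^ N - C c) = 0 := by
  have := AdjoinRoot.mk_self (f := X ^ N - C (algebraMap F (ChainRing F) c))
  rw [map_sub, map_pow, AdjoinRoot.mk_X, AdjoinRoot.mk_C] at this
  rw [cls, map_sub, map_pow, aeval_X, aeval_C]
  exact this

/-- The inclusion of `F[x]/⟨(x^n - α₀)^q⟩` in the constacyclic ring. -/
noncomputable def incl (h : binom n α₀ ^ q = X ^ (n * q) - C (α₀ ^ q)) :
    AdjoinRoot (binom n α₀ ^ q) →ₐ[F] ConstaRing F (n * q) (alpha q α₀) :=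
  AdjoinRoot.liftAlgHom _ (Algebra.ofId F _) (AdjoinRoot.root _) (by
    rw [h]
    exact cls_X_pow_sub_C _ _)

theorem incl_mk (h : binom n α₀ ^ q = X ^ (n * q) - C (α₀ ^ q)) (a : F[X]) :
    incl h (AdjoinRoot.mk _ a) = cls _ _ a := by
  rw [incl, AdjoinRoot.liftAlgHom_mk]
  rfl

/-- The map `(a, b, c) ↦ a + u b + u² c`. -/
noncomputable def expand (h : binom n α₀ ^ q = X ^ (n * q) - C (α₀ ^ q)) :
    (AdjoinRoot (binom n α₀ ^ q) × AdjoinRoot (binom n α₀ ^ q) × AdjoinRoot (binom n α₀ ^ q)) →ₗ[F]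
      ConstaRing F (n * q) (alpha q α₀) :=
  (incl h).toLinearMap.coprod
    (((LinearMap.mulLeft F (uu _ _)) ∘ₗ (incl h).toLinearMap).coprod
      ((LinearMap.mulLeft F (uu _ _ ^ 2)) ∘ₗ (incl h).toLinearMap))

theorem expand_apply (h : binom n α₀ ^ q = X ^ (n * q) - C (α₀ ^ q))
    (a b c : AdjoinRoot (binom n α₀ ^ q)) :
    expand h (a, b, c) = incl h a + uu _ _ * incl h b + uu _ _ ^ 2 * incl h c := by
  simp [expand, add_assoc]

theorem expand_surjective (h : binom n α₀ ^ q = X ^ (n * q) - C (α₀ ^ q)) :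
    Function.Surjective (expand h) := by
  rw [← LinearMap.range_eq_top, eq_top_iff]
  rintro z -
  obtain ⟨P, rfl⟩ := AdjoinRoot.mk_surjective z
  induction P using Polynomial.induction_on' with
  | add P Q hP hQ => rw [map_add]; exact add_mem hP hQ
  | monomial j r =>
    obtain ⟨g, rfl⟩ := AdjoinRoot.mk_surjective r
    induction g using Polynomial.induction_on' with
    | add P Q hP hQ => rw [map_add, map_add, map_add]; exact add_mem hP hQ
    | monomial i r =>
      have hz : AdjoinRoot.mk (X ^ (n * q) - C (alpha q α₀))
          (monomial j (AdjoinRoot.mk (X ^ 3) (monomial i r))) =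
          uu _ _ ^ i * incl h (AdjoinRoot.mk _ (C r * X ^ j)) := by
        rw [incl_mk, ← C_mul_X_pow_eq_monomial, ← C_mul_X_pow_eq_monomial, cls, uu]
        simp only [map_mul, map_pow, AdjoinRoot.mk_X, AdjoinRoot.mk_C, aeval_X, aeval_C]
        have : AdjoinRoot.of (X ^ (n * q) - C (alpha q α₀)) (AdjoinRoot.of (X ^ 3) r) =
          algebraMap F _ r := rfl
        rw [this]
        ring
      rw [hz]
      generalize AdjoinRoot.mk (binom n α₀ ^ q) (C r * X ^ j) = y
      match i with
      | 0 => exact ⟨(y, 0, 0), by rw [expand_apply]; simp⟩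
      | 1 => exact ⟨(0, y, 0), by rw [expand_apply]; simp⟩
      | 2 => exact ⟨(0, 0, y), by rw [expand_apply]; simp⟩
      | i + 3 =>
        rw [pow_add, uu_pow_three, mul_zero, zero_mul]
        exact zero_mem _

theorem binom_monic (hn : n ≠ 0) : (binom n α₀).Monic := monic_X_pow_sub_C α₀ hn

theorem finrank_adjoinRoot_binom_pow (hn : n ≠ 0) (i : ℕ) :
    Module.finrank F (AdjoinRoot (binom n α₀ ^ i)) = n * i := by
  have hm := (binom_monic (α₀ := α₀) hn).pow i
  rw [(AdjoinRoot.powerBasis' hm).finrank, AdjoinRoot.powerBasis'_dim,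
    (binom_monic hn).natDegree_pow, natDegree_X_pow_sub_C, mul_comm]

theorem finite_adjoinRoot_binom_pow (hn : n ≠ 0) (i : ℕ) :
    Module.Finite F (AdjoinRoot (binom n α₀ ^ i)) :=
  ((binom_monic (α₀ := α₀) hn).pow i).finite_adjoinRoot

/-- Surjectivity is visible on the monomials `u^i x^j`; both sides have dimension `3nq`. -/
theorem expand_bijective (hn : n ≠ 0) (hq : q ≠ 0)
    (h : binom n α₀ ^ q = X ^ (n * q) - C (α₀ ^ q)) : Function.Bijective (expand h) := by
  have := finite_adjoinRoot_binom_pow (α₀ := α₀) hn q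
  have := finite_constaRing (F := F) (lam := alpha q α₀) (mul_ne_zero hn hq)
  refine ⟨?_, expand_surjective h⟩
  rw [LinearMap.injective_iff_surjective_of_finrank_eq_finrank]
  · exact expand_surjective h
  · rw [Module.finrank_prod, Module.finrank_prod, finrank_adjoinRoot_binom_pow hn,
      finrank_constaRing (mul_ne_zero hn hq)]
    ring

/-- The constacyclic ring as the `F`-space of the triples of its coordinates on `1, u, u²`. -/
noncomputable def coords (hn : n ≠ 0) (hq : q ≠ 0)
    (h : binom n α₀ ^ q = X ^ (n * q) - C (α₀ ^ q)) :
    (AdjoinRoot (binom n α₀ ^ q) × AdjoinRoot (binom n α₀ ^ q) × AdjoinRoot (binom n α₀ ^ q)) ≃ₗ[F]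
      ConstaRing F (n * q) (alpha q α₀) :=
  LinearEquiv.ofBijective (expand h) (expand_bijective hn hq h)

theorem expand_eq_zero_iff (hn : n ≠ 0) (hq : q ≠ 0)
    (h : binom n α₀ ^ q = X ^ (n * q) - C (α₀ ^ q)) (a b c : AdjoinRoot (binom n α₀ ^ q)) :
    incl h a + uu _ _ * incl h b + uu _ _ ^ 2 * incl h c = 0 ↔ a = 0 ∧ b = 0 ∧ c = 0 := by
  rw [← expand_apply, map_eq_zero_iff _ (expand_bijective hn hq h).1]
  simp

theorem mem_resU_iff (h : binom n α₀ ^ q = X ^ (n * q) - C (α₀ ^ q))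
    {I : Ideal (ConstaRing F (n * q) (alpha q α₀))} {z : AdjoinRoot (binom n α₀ ^ q)} :
    z ∈ resU I ↔ ∃ b c, incl h z + uu _ _ * incl h b + uu _ _ ^ 2 * incl h c ∈ I := by
  constructor
  · rintro ⟨a, b, c, rfl, hI⟩
    exact ⟨AdjoinRoot.mk _ b, AdjoinRoot.mk _ c, by simpa only [incl_mk] using hI⟩
  · rintro ⟨b, c, hI⟩
    obtain ⟨a, rfl⟩ := AdjoinRoot.mk_surjective z
    obtain ⟨b, rfl⟩ := AdjoinRoot.mk_surjective b
    obtain ⟨c, rfl⟩ := AdjoinRoot.mk_surjective c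
    exact ⟨a, b, c, rfl, by simpa only [incl_mk] using hI⟩

theorem mem_torU_iff (h : binom n α₀ ^ q = X ^ (n * q) - C (α₀ ^ q))
    {I : Ideal (ConstaRing F (n * q) (alpha q α₀))} {z : AdjoinRoot (binom n α₀ ^ q)} :
    z ∈ torU I ↔ ∃ c, uu _ _ * incl h z + uu _ _ ^ 2 * incl h c ∈ I := by
  constructor
  · rintro ⟨b, c, rfl, hI⟩
    exact ⟨AdjoinRoot.mk _ c, by simpa only [incl_mk] using hI⟩
  · rintro ⟨c, hI⟩
    obtain ⟨b, rfl⟩ := AdjoinRoot.mk_surjective z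
    obtain ⟨c, rfl⟩ := AdjoinRoot.mk_surjective c
    exact ⟨b, c, rfl, by simpa only [incl_mk] using hI⟩

theorem mem_torU2_iff (h : binom n α₀ ^ q = X ^ (n * q) - C (α₀ ^ q))
    {I : Ideal (ConstaRing F (n * q) (alpha q α₀))} {z : AdjoinRoot (binom n α₀ ^ q)} :
    z ∈ torU2 I ↔ uu _ _ ^ 2 * incl h z ∈ I := by
  constructor
  · rintro ⟨c, rfl, hI⟩
    simpa only [incl_mk] using hI
  · intro hI
    obtain ⟨c, rfl⟩ := AdjoinRoot.mk_surjective z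
    exact ⟨c, rfl, by simpa only [incl_mk] using hI⟩

theorem mem_powIdeal_iff {i : ℕ} {z : AdjoinRoot (binom n α₀ ^ q)} :
    z ∈ powIdeal n q α₀ i ↔ ∃ y, z = AdjoinRoot.mk _ (binom n α₀) ^ i * y := by
  rw [powIdeal, map_pow, Ideal.mem_span_singleton]
  rfl

theorem mk_binom_pow_eq_zero : AdjoinRoot.mk (binom n α₀ ^ q) (binom n α₀) ^ q = 0 := by
  rw [← map_pow, AdjoinRoot.mk_self]

theorem mk_binom_pow_mul_eq_zero_iff (hn : n ≠ 0) {i j : ℕ} (hij : i + j = q)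
    {z : AdjoinRoot (binom n α₀ ^ q)} :
    AdjoinRoot.mk _ (binom n α₀) ^ i * z = 0 ↔ z ∈ powIdeal n q α₀ j := by
  rw [mem_powIdeal_iff]
  constructor
  · intro hz
    obtain ⟨a, rfl⟩ := AdjoinRoot.mk_surjective z
    rw [← map_pow, ← map_mul, AdjoinRoot.mk_eq_zero] at hz
    obtain ⟨r, hr⟩ := hz
    refine ⟨AdjoinRoot.mk _ r, ?_⟩
    rw [← map_pow, ← map_mul]
    congr 1
    apply mul_left_cancel₀ (pow_ne_zero i (binom_monic (α₀ := α₀) hn).ne_zero)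
    rw [hr, ← hij, pow_add, mul_assoc]
  · rintro ⟨y, rfl⟩
    rw [← mul_assoc, ← pow_add, hij, mk_binom_pow_eq_zero, zero_mul]

theorem mk_binom_pow_ne_zero (hn : n ≠ 0) {i : ℕ} (hi : i < q) :
    AdjoinRoot.mk (binom n α₀ ^ q) (binom n α₀) ^ i ≠ 0 := by
  rw [← map_pow]
  refine AdjoinRoot.mk_ne_zero_of_natDegree_lt ((binom_monic hn).pow q)
    (pow_ne_zero i (binom_monic hn).ne_zero) ?_
  rw [(binom_monic hn).natDegree_pow, (binom_monic hn).natDegree_pow, natDegree_X_pow_sub_C]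
  exact Nat.mul_lt_mul_of_pos_right hi (Nat.pos_of_ne_zero hn)

/-- The ideal is the kernel of the projection `F[x]/⟨f^q⟩ → F[x]/⟨f^i⟩`. -/
theorem finrank_powIdeal_add (hn : n ≠ 0) {i : ℕ} (hi : i ≤ q) :
    Module.finrank F ((powIdeal n q α₀ i).restrictScalars F) + n * i = n * q := by
  have := finite_adjoinRoot_binom_pow (α₀ := α₀) hn q
  let φ : AdjoinRoot (binom n α₀ ^ q) →ₐ[F] AdjoinRoot (binom n α₀ ^ i) :=
    AdjoinRoot.algHomOfDvd F _ _ (pow_dvd_pow _ hi)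
  have hφ : ∀ a, φ (AdjoinRoot.mk _ a) = AdjoinRoot.mk _ a := by
    intro a
    induction a using Polynomial.induction_on' with
    | add P Q hP hQ => simp [hP, hQ]
    | monomial j r =>
      rw [← C_mul_X_pow_eq_monomial]
      simp [φ, AdjoinRoot.algHomOfDvd]
  have hsurj : Function.Surjective φ.toLinearMap := by
    intro z
    obtain ⟨a, rfl⟩ := AdjoinRoot.mk_surjective z
    exact ⟨AdjoinRoot.mk _ a, hφ a⟩
  have hker : LinearMap.ker φ.toLinearMap = (powIdeal n q α₀ i).restrictScalars F := by
    ext z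
    obtain ⟨a, rfl⟩ := AdjoinRoot.mk_surjective z
    rw [LinearMap.mem_ker, AlgHom.toLinearMap_apply, hφ, AdjoinRoot.mk_eq_zero,
      Submodule.restrictScalars_mem, mem_powIdeal_iff]
    constructor
    · rintro ⟨r, rfl⟩
      exact ⟨AdjoinRoot.mk _ r, by rw [map_mul, map_pow]⟩
    · rintro ⟨y, hy⟩
      obtain ⟨r, rfl⟩ := AdjoinRoot.mk_surjective y
      rw [← map_pow, ← map_mul, AdjoinRoot.mk_eq_mk] at hy
      have := dvd_add ((pow_dvd_pow _ hi).trans hy) (dvd_mul_right (binom n α₀ ^ i) r)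
      simpa using this
  have h := LinearMap.finrank_range_add_finrank_ker φ.toLinearMap
  rw [LinearMap.range_eq_top.2 hsurj, finrank_top, hker, finrank_adjoinRoot_binom_pow hn,
    finrank_adjoinRoot_binom_pow hn] at h
  omega

/-- Filtering by powers of `u`, the successive layers of `I` are its residue and torsion ideals. -/
theorem finrank_ideal_add (hn : n ≠ 0) (hq : q ≠ 0)
    (h : binom n α₀ ^ q = X ^ (n * q) - C (α₀ ^ q))
    {I : Ideal (ConstaRing F (n * q) (alpha q α₀))} {a b c : ℕ} (hI : HasExponents I a b c) :
    Module.finrank F (I.restrictScalars F) + n * (a + b + c) = 3 * (n * q) := by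
  obtain ⟨-, -, hcb, hba, haq, hr, ht, ht2⟩ := hI
  have := finite_adjoinRoot_binom_pow (α₀ := α₀) hn q
  set W := (I.restrictScalars F).comap (coords hn hq h).toLinearMap with hW
  have hmem : ∀ x y z, (x, y, z) ∈ W ↔
      incl h x + uu _ _ * incl h y + uu _ _ ^ 2 * incl h z ∈ I := by
    intro x y z
    rw [← expand_apply]
    rfl
  have hWI : Module.finrank F W = Module.finrank F (I.restrictScalars F) :=
    ((coords hn hq h).ofSubmodule' (I.restrictScalars F)).finrank_eq
  rw [← hWI, finrank_submodule_prod, finrank_submodule_prod (W.comap _)]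
  have h0 : W.map (LinearMap.fst F _ _) = (powIdeal n q α₀ a).restrictScalars F := by
    ext z
    rw [Submodule.restrictScalars_mem, ← SetLike.mem_coe (p := powIdeal n q α₀ a), ← hr,
      mem_resU_iff h]
    simp [hmem]
  have h1 : (W.comap (LinearMap.inr F _ _)).map (LinearMap.fst F _ _) =
      (powIdeal n q α₀ b).restrictScalars F := by
    ext z
    rw [Submodule.restrictScalars_mem, ← SetLike.mem_coe (p := powIdeal n q α₀ b), ← ht,
      mem_torU_iff h]
    simp [hmem]
  have h2 : (W.comap (LinearMap.inr F _ _)).comap (LinearMap.inr F _ _) =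
      (powIdeal n q α₀ c).restrictScalars F := by
    ext z
    rw [Submodule.restrictScalars_mem, ← SetLike.mem_coe (p := powIdeal n q α₀ c), ← ht2,
      mem_torU2_iff h]
    simp [hmem]
  rw [h0, h1, h2]
  have e0 := finrank_powIdeal_add (α₀ := α₀) hn haq
  have e1 := finrank_powIdeal_add (α₀ := α₀) hn (hba.trans haq)
  have e2 := finrank_powIdeal_add (α₀ := α₀) hn (hcb.trans (hba.trans haq))
  rw [mul_add, mul_add]
  omega

end Coordinates

/-! ### Numerical constraints on isodual codes. -/

section Isodual

variable {F : Type*} [Field F] {n q : ℕ} {α₀ : F}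

theorem incl_mk_binom (h : binom n α₀ ^ q = X ^ (n * q) - C (α₀ ^ q)) :
    incl h (AdjoinRoot.mk _ (binom n α₀)) = cls _ _ (X ^ n - C α₀) := incl_mk h _

theorem uu_sq_mul_incl_eq_zero_iff (hn : n ≠ 0) (hq : q ≠ 0)
    (h : binom n α₀ ^ q = X ^ (n * q) - C (α₀ ^ q)) (z : AdjoinRoot (binom n α₀ ^ q)) :
    uu (n * q) (alpha q α₀) ^ 2 * incl h z = 0 ↔ z = 0 := by
  have := expand_eq_zero_iff hn hq h 0 0 z
  simpa using this

theorem exists_coords (hn : n ≠ 0) (hq : q ≠ 0) (h : binom n α₀ ^ q = X ^ (n * q) - C (α₀ ^ q))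
    (w : ConstaRing F (n * q) (alpha q α₀)) :
    ∃ x y z, w = incl h x + uu _ _ * incl h y + uu _ _ ^ 2 * incl h z := by
  obtain ⟨⟨x, y, z⟩, rfl⟩ := (expand_bijective hn hq h).2 w
  exact ⟨x, y, z, expand_apply h x y z⟩

/-- Since `u³ = 0`, multiplication by `u² t` sees only the residue of an element of `I`, so the
condition on `t` is `f^a t = 0`. -/
theorem torU2_annihilator (hn : n ≠ 0) (hq : q ≠ 0)
    (h : binom n α₀ ^ q = X ^ (n * q) - C (α₀ ^ q))
    {I : Ideal (ConstaRing F (n * q) (alpha q α₀))} {a : ℕ} (ha : a ≤ q)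
    (hr : resU I = powIdeal n q α₀ a) :
    torU2 I.annihilator = powIdeal n q α₀ (q - a) := by
  have hu := uu_pow_three (F := F) (n * q) (alpha q α₀)
  have hmul : ∀ x y z t : AdjoinRoot (binom n α₀ ^ q),
      uu _ _ ^ 2 * incl h t * (incl h x + uu _ _ * incl h y + uu _ _ ^ 2 * incl h z) =
        uu _ _ ^ 2 * incl h (x * t) := by
    intro x y z t
    rw [map_mul]
    linear_combination (incl h t * (incl h y + uu _ _ * incl h z)) * hu
  ext t
  rw [mem_torU2_iff h, Submodule.mem_annihilator, SetLike.mem_coe,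
    ← mk_binom_pow_mul_eq_zero_iff hn (Nat.add_sub_of_le ha)]
  constructor
  · intro ht
    have hmem : AdjoinRoot.mk _ (binom n α₀) ^ a ∈ resU I := by
      rw [hr, SetLike.mem_coe, mem_powIdeal_iff]
      exact ⟨1, (mul_one _).symm⟩
    obtain ⟨y, z, hI⟩ := (mem_resU_iff h).1 hmem
    have := ht _ hI
    rwa [smul_eq_mul, hmul, uu_sq_mul_incl_eq_zero_iff hn hq] at this
  · intro ht w hw
    obtain ⟨x, y, z, rfl⟩ := exists_coords hn hq h w
    have hx : x ∈ resU I := (mem_resU_iff h).2 ⟨y, z, hw⟩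
    rw [hr, SetLike.mem_coe, mem_powIdeal_iff] at hx
    obtain ⟨x, rfl⟩ := hx
    rw [smul_eq_mul, hmul, mul_right_comm, ht, zero_mul, map_zero, mul_zero]

/-- The elements of an ideal that are killed by `u`. -/
noncomputable def uKernel {N : ℕ} {lam : ChainRing F} (I : Ideal (ConstaRing F N lam)) :
    Submodule F (ConstaRing F N lam) :=
  I.restrictScalars F ⊓ LinearMap.ker (LinearMap.mulLeft F (uu N lam))

/-- The kernel of `u` in the whole ring is `u²A`, so inside `I` it is a copy of the last torsion
ideal. -/
theorem finrank_uKernel_add (hn : n ≠ 0) (hq : q ≠ 0)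
    (h : binom n α₀ ^ q = X ^ (n * q) - C (α₀ ^ q))
    {I : Ideal (ConstaRing F (n * q) (alpha q α₀))} {c : ℕ} (hc : c ≤ q)
    (ht : torU2 I = powIdeal n q α₀ c) :
    Module.finrank F (uKernel I) + n * c = n * q := by
  have hu := uu_pow_three (F := F) (n * q) (alpha q α₀)
  let ψ := LinearMap.mulLeft F (uu (n * q) (alpha q α₀) ^ 2) ∘ₗ (incl h).toLinearMap
  have hψ : Function.Injective ψ := by
    rw [injective_iff_map_eq_zero]
    intro z hz
    exact (uu_sq_mul_incl_eq_zero_iff hn hq h z).1 hz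
  have hmap : ((powIdeal n q α₀ c).restrictScalars F).map ψ = uKernel I := by
    ext w
    constructor
    · rintro ⟨z, hz, rfl⟩
      refine ⟨?_, ?_⟩
      · change z ∈ (powIdeal n q α₀ c : Set _) at hz
        rw [← ht, mem_torU2_iff h] at hz
        exact hz
      · change uu _ _ * (uu _ _ ^ 2 * incl h z) = 0
        linear_combination incl h z * hu
    · rintro ⟨hw, hk⟩
      change w ∈ I at hw
      change uu _ _ * w = 0 at hk
      obtain ⟨x, y, z, rfl⟩ := exists_coords hn hq h w
      have h0 : incl h 0 + uu _ _ * incl h x + uu _ _ ^ 2 * incl h y = 0 := by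
        rw [map_zero]
        linear_combination hk - incl h z * hu
      obtain ⟨-, rfl, rfl⟩ := (expand_eq_zero_iff hn hq h _ _ _).1 h0
      rw [map_zero, mul_zero, add_zero, zero_add] at hw ⊢
      refine ⟨z, ?_, rfl⟩
      change z ∈ (powIdeal n q α₀ c : Set _)
      rwa [← ht, mem_torU2_iff h]
  rw [← hmap, ← (Submodule.equivMapOfInjective ψ hψ _).finrank_eq]
  exact finrank_powIdeal_add hn hc

theorem finrank_uKernel_le {N : ℕ} (hN : N ≠ 0) {lam : ChainRing F}
    {I J : Ideal (ConstaRing F N lam)}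
    (e : I.restrictScalars (ChainRing F) ≃ₗ[ChainRing F] J.restrictScalars (ChainRing F)) :
    Module.finrank F (uKernel I) ≤ Module.finrank F (uKernel J) := by
  have := finite_constaRing (F := F) (lam := lam) hN
  have hsmul : ∀ w : ConstaRing F N lam,
      uu N lam * w = AdjoinRoot.root (X ^ 3 : F[X]) • w := fun w => by
    rw [Algebra.smul_def]
    rfl
  let φ : uKernel I →ₗ[F] uKernel J :=
    { toFun := fun x => ⟨(e ⟨x.1, x.2.1⟩ : ConstaRing F N lam), (e ⟨x.1, x.2.1⟩).2, by
        have hx : uu N lam * x.1 = 0 := x.2.2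
        change uu N lam * _ = 0
        rw [hsmul] at hx ⊢
        rw [← Submodule.coe_smul, ← map_smul]
        have : AdjoinRoot.root (X ^ 3 : F[X]) •
          (⟨x.1, x.2.1⟩ : I.restrictScalars (ChainRing F)) = 0 := Subtype.ext hx
        rw [this, map_zero]
        rfl⟩
      map_add' := fun x y => by
        have h := congrArg Subtype.val (e.map_add ⟨x.1, x.2.1⟩ ⟨y.1, y.2.1⟩)
        exact Subtype.ext h
      map_smul' := fun r x => by
        have h := congrArg Subtype.val ((e.restrictScalars F).map_smul r ⟨x.1, x.2.1⟩)
        exact Subtype.ext h }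
  refine LinearMap.finrank_le_finrank_of_injective (f := φ) ?_
  intro x y hxy
  have h := congrArg Subtype.val hxy
  have h' := congrArg Subtype.val (e.injective (Subtype.ext h))
  exact Subtype.ext h'

theorem HasExponents.add_eq_of_isomorphic (hn : n ≠ 0) (hq : q ≠ 0)
    (h : binom n α₀ ^ q = X ^ (n * q) - C (α₀ ^ q))
    {I : Ideal (ConstaRing F (n * q) (alpha q α₀))} {a b c : ℕ} (hI : HasExponents I a b c)
    (hiso : LinearlyIsomorphic (words I) (dualCode (words I))) :
    a + c = q ∧ 2 * b = q := by
  have hN := mul_ne_zero hn hq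
  obtain ⟨e⟩ := nonempty_equiv_annihilator hN hiso
  have hdim := finrank_ideal_add hn hq h hI
  obtain ⟨-, -, hcb, hba, haq, hr, -, ht2⟩ := hI
  have hsum := finrank_add_finrank_annihilator hN I
  have heq : Module.finrank F (I.restrictScalars F) =
    Module.finrank F (I.annihilator.restrictScalars F) := (e.restrictScalars F).finrank_eq
  have hk := le_antisymm (finrank_uKernel_le hN e) (finrank_uKernel_le hN e.symm)
  have hk1 := finrank_uKernel_add hn hq h (hcb.trans (hba.trans haq)) ht2
  have hk2 := finrank_uKernel_add hn hq h (Nat.sub_le q a) (torU2_annihilator hn hq h haq hr)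
  have hc : n * c = n * (q - a) := by omega
  have hc := Nat.eq_of_mul_eq_mul_left (Nat.pos_of_ne_zero hn) hc
  have hs : n * (2 * (a + b + c)) = n * (3 * q) := by
    linarith
  have hs := Nat.eq_of_mul_eq_mul_left (Nat.pos_of_ne_zero hn) hs
  omega

/-! ### Self-annihilating ideals in characteristic 2, and ideals with `a = q`, `c = 0`. -/

section SelfAnnihilating

variable {e a : ℕ} {t : ConstaRing F (n * q) (alpha q α₀)}
  {I : Ideal (ConstaRing F (n * q) (alpha q α₀))}

theorem span_le_annihilator [CharP F 2] (h : binom n α₀ ^ q = X ^ (n * q) - C (α₀ ^ q))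
    (he : 2 * e = q) (hea : e ≤ a) (haq : a ≤ q) {f u : ConstaRing F (n * q) (alpha q α₀)}
    (hf : f = cls _ _ (X ^ n - C α₀)) (hu : u = uu _ _)
    (hI : I = Ideal.span {f ^ a + u ^ 2 * t, u * f ^ e, u ^ 2 * f ^ (q - a)}) :
    I ≤ I.annihilator := by
  have hf0 : ∀ k, q ≤ k → f ^ k = 0 := by
    intro k hk
    obtain ⟨j, rfl⟩ := Nat.exists_eq_add_of_le hk
    rw [pow_add, hf, ← incl_mk_binom h, ← map_pow, mk_binom_pow_eq_zero, map_zero, zero_mul]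
  have hu3 : u ^ 3 = 0 := by rw [hu, uu_pow_three]
  have h2 : (2 : ConstaRing F (n * q) (alpha q α₀)) = 0 := by
    have : (2 : F) = 0 := CharTwo.two_eq_zero
    rw [← map_ofNat (algebraMap F (ConstaRing F (n * q) (alpha q α₀))) 2, this, map_zero]
  have haa : f ^ a * f ^ a = 0 := by rw [← pow_add]; exact hf0 _ (by omega)
  have hae : f ^ a * f ^ e = 0 := by rw [← pow_add]; exact hf0 _ (by omega)
  have hee : f ^ e * f ^ e = 0 := by rw [← pow_add]; exact hf0 _ (by omega)
  have haq' : f ^ a * f ^ (q - a) = 0 := by rw [← pow_add]; exact hf0 _ (by omega)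
  rw [Submodule.le_annihilator_iff, smul_eq_mul, hI, Ideal.span_mul_span', eq_bot_iff,
    Ideal.span_le]
  rintro w ⟨x, hx, y, hy, rfl⟩
  simp only [Set.mem_insert_iff, Set.mem_singleton_iff] at hx hy
  simp only [Submodule.bot_coe, Set.mem_singleton_iff]
  rcases hx with rfl | rfl | rfl <;> rcases hy with rfl | rfl | rfl
  -- The square of the first generator has the cross term `2u² t f^a`, which needs characteristic 2.
  · linear_combination haa + u * t ^ 2 * hu3 + u ^ 2 * t * f ^ a * h2
  · linear_combination u * hae + t * f ^ e * hu3
  · linear_combination u ^ 2 * haq' + u * t * f ^ (q - a) * hu3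
  · linear_combination u * hae + t * f ^ e * hu3
  · linear_combination u ^ 2 * hee
  · linear_combination f ^ e * f ^ (q - a) * hu3
  · linear_combination u ^ 2 * haq' + u * t * f ^ (q - a) * hu3
  · linear_combination f ^ e * f ^ (q - a) * hu3
  · linear_combination u * f ^ (q - a) * f ^ (q - a) * hu3

/-- Testing an annihilating element against the generators in reverse order bounds its first nonzero
layer by `f^a`, `f^e`, `f^(q-a)`. These are the leading terms of the generators, so multiples of
them can be peeled off layer by layer; the same bounds give the exponents. -/
theorem annihilator_eq_and_hasExponents [CharP F 2] (hn : n ≠ 0) (hq : q ≠ 0)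
    (h : binom n α₀ ^ q = X ^ (n * q) - C (α₀ ^ q))
    (he : 2 * e = q) (hea : e ≤ a) (haq : a ≤ q) {f u : ConstaRing F (n * q) (alpha q α₀)}
    (hf : f = cls _ _ (X ^ n - C α₀)) (hu : u = uu _ _)
    (hI : I = Ideal.span {f ^ a + u ^ 2 * t, u * f ^ e, u ^ 2 * f ^ (q - a)}) :
    I.annihilator = I ∧ HasExponents I a e (q - a) := by
  have hle := span_le_annihilator h he hea haq hf hu hI
  have hu3 := uu_pow_three (F := F) (n * q) (alpha q α₀)
  have hfk : ∀ k, f ^ k = incl h (AdjoinRoot.mk _ (binom n α₀) ^ k) := by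
    intro k
    rw [map_pow, incl_mk_binom, hf]
  -- Only the residue of `t` survives multiplication by `u²`.
  obtain ⟨t₀, ht₀⟩ : ∃ t₀, u ^ 2 * t = uu _ _ ^ 2 * incl h t₀ := by
    obtain ⟨x, y, z, rfl⟩ := exists_coords hn hq h t
    exact ⟨x, by rw [hu]; linear_combination (incl h y + uu _ _ * incl h z) * hu3⟩
  rw [hfk, hfk, hfk, ht₀, hu] at hI
  set π := AdjoinRoot.mk (binom n α₀ ^ q) (binom n α₀)
  have g1 : incl h (π ^ a) + uu _ _ ^ 2 * incl h t₀ ∈ I := by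
    rw [hI]; exact Ideal.subset_span (by simp)
  have g2 : uu _ _ * incl h (π ^ e) ∈ I := by
    rw [hI]; exact Ideal.subset_span (by simp)
  have g3 : uu _ _ ^ 2 * incl h (π ^ (q - a)) ∈ I := by
    rw [hI]; exact Ideal.subset_span (by simp)
  have k3 : ∀ x y z, incl h x + uu _ _ * incl h y + uu _ _ ^ 2 * incl h z ∈ I.annihilator →
      x ∈ powIdeal n q α₀ a := by
    intro x y z hw
    have := Submodule.mem_annihilator.1 hw _ g3
    rw [← mk_binom_pow_mul_eq_zero_iff hn (Nat.sub_add_cancel haq),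
      ← uu_sq_mul_incl_eq_zero_iff hn hq h, map_mul]
    rw [smul_eq_mul] at this
    linear_combination this - (incl h y + uu _ _ * incl h z) * incl h (π ^ (q - a)) * hu3
  have k2 : ∀ y z, uu _ _ * incl h y + uu _ _ ^ 2 * incl h z ∈ I.annihilator →
      y ∈ powIdeal n q α₀ e := by
    intro y z hw
    have := Submodule.mem_annihilator.1 hw _ g2
    rw [← mk_binom_pow_mul_eq_zero_iff hn (show e + e = q by omega),
      ← uu_sq_mul_incl_eq_zero_iff hn hq h, map_mul]
    rw [smul_eq_mul] at this
    linear_combination this - incl h z * incl h (π ^ e) * hu3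
  have k1 : ∀ z, uu _ _ ^ 2 * incl h z ∈ I.annihilator → z ∈ powIdeal n q α₀ (q - a) := by
    intro z hw
    have := Submodule.mem_annihilator.1 hw _ g1
    rw [← mk_binom_pow_mul_eq_zero_iff hn (Nat.add_sub_of_le haq),
      ← uu_sq_mul_incl_eq_zero_iff hn hq h, map_mul]
    rw [smul_eq_mul] at this
    linear_combination this - uu _ _ * incl h z * incl h t₀ * hu3
  have hann : I.annihilator = I := by
    refine le_antisymm ?_ hle
    intro w hw
    obtain ⟨x, y, z, rfl⟩ := exists_coords hn hq h w
    obtain ⟨x', rfl⟩ := mem_powIdeal_iff.1 (k3 x y z hw)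
    have s1 := I.mul_mem_right (incl h x') g1
    have hw1 : uu _ _ * incl h y + uu _ _ ^ 2 * incl h (z - t₀ * x') ∈ I.annihilator := by
      convert sub_mem hw (hle s1) using 1
      rw [map_sub, map_mul, map_mul]
      ring
    obtain ⟨y', rfl⟩ := mem_powIdeal_iff.1 (k2 _ _ hw1)
    have s2 := I.mul_mem_right (incl h y') g2
    have hw2 : uu _ _ ^ 2 * incl h (z - t₀ * x') ∈ I.annihilator := by
      convert sub_mem hw1 (hle s2) using 1
      rw [map_mul]
      ring
    obtain ⟨z', hz'⟩ := mem_powIdeal_iff.1 (k1 _ hw2)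
    have s3 := I.mul_mem_right (incl h z') g3
    rw [sub_eq_iff_eq_add] at hz'
    rw [hz']
    convert add_mem (add_mem s1 s2) s3 using 1
    simp only [map_add, map_mul]
    ring
  rw [hann] at k1 k2 k3
  refine ⟨hann, ?_, ?_, by omega, hea, haq, ?_, ?_, ?_⟩
  · rintro rfl
    have h0 := expand_eq_zero_iff hn hq h 0 (π ^ e) 0
    rw [map_zero, mul_zero, zero_add, add_zero] at h0
    exact mk_binom_pow_ne_zero hn (by omega) (h0.1 g2).2.1
  · rintro rfl
    have h1 : (1 : ConstaRing F (n * q) (alpha q α₀)) = 0 := by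
      simpa using Submodule.mem_annihilator.1 (hle Submodule.mem_top : (1 : ConstaRing F (n * q)
        (alpha q α₀)) ∈ _) 1 Submodule.mem_top
    have h2 := (expand_eq_zero_iff hn hq h 1 0 0).1 (by simp [h1])
    exact mk_binom_pow_ne_zero (α₀ := α₀) (i := 0) hn (Nat.pos_of_ne_zero hq) (by rw [pow_zero]; exact h2.1)
  · ext x
    rw [mem_resU_iff h, SetLike.mem_coe]
    refine ⟨fun ⟨y, z, hw⟩ => k3 x y z hw, fun hx => ?_⟩
    obtain ⟨x', rfl⟩ := mem_powIdeal_iff.1 hx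
    refine ⟨0, t₀ * x', ?_⟩
    convert I.mul_mem_right (incl h x') g1 using 1
    simp only [map_mul, map_zero]
    ring
  · ext y
    rw [mem_torU_iff h, SetLike.mem_coe]
    refine ⟨fun ⟨z, hw⟩ => k2 y z hw, fun hy => ?_⟩
    obtain ⟨y', rfl⟩ := mem_powIdeal_iff.1 hy
    refine ⟨0, ?_⟩
    convert I.mul_mem_right (incl h y') g2 using 1
    simp only [map_mul, map_zero]
    ring
  · ext z
    rw [mem_torU2_iff h, SetLike.mem_coe]
    refine ⟨fun hw => k1 z hw, fun hz => ?_⟩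
    obtain ⟨z', rfl⟩ := mem_powIdeal_iff.1 hz
    convert I.mul_mem_right (incl h z') g3 using 1
    simp only [map_mul]
    ring

theorem HasExponents.eq_span (hn : n ≠ 0) (hq : q ≠ 0)
    (h : binom n α₀ ^ q = X ^ (n * q) - C (α₀ ^ q)) {b : ℕ} (hI : HasExponents I q b 0) :
    I = Ideal.span {uu _ _ * cls _ _ (X ^ n - C α₀) ^ b, uu _ _ ^ 2} := by
  obtain ⟨-, -, -, -, -, hr, ht, ht2⟩ := hI
  rw [← incl_mk_binom h, ← map_pow]
  have hu2 : uu _ _ ^ 2 ∈ I := by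
    have h1 : (1 : AdjoinRoot (binom n α₀ ^ q)) ∈ torU2 I := by
      rw [ht2, SetLike.mem_coe, mem_powIdeal_iff]
      exact ⟨1, by simp⟩
    simpa [mem_torU2_iff h] using h1
  apply le_antisymm
  · intro w hw
    obtain ⟨x, y, z, rfl⟩ := exists_coords hn hq h w
    have hx : x ∈ resU I := (mem_resU_iff h).2 ⟨y, z, hw⟩
    rw [hr, SetLike.mem_coe, mem_powIdeal_iff, mk_binom_pow_eq_zero] at hx
    obtain ⟨-, rfl⟩ : ∃ _ : AdjoinRoot (binom n α₀ ^ q), x = 0 := by simpa using hx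
    rw [map_zero, zero_add] at hw ⊢
    have hy : y ∈ torU I := (mem_torU_iff h).2 ⟨z, hw⟩
    rw [ht, SetLike.mem_coe, mem_powIdeal_iff] at hy
    obtain ⟨y', rfl⟩ := hy
    refine add_mem ?_ (Ideal.mul_mem_right _ _ (Ideal.subset_span (by simp)))
    rw [map_mul, ← mul_assoc]
    exact Ideal.mul_mem_right _ _ (Ideal.subset_span (by simp))
  · rw [Ideal.span_le]
    rintro w (rfl | rfl)
    · have hy : AdjoinRoot.mk _ (binom n α₀) ^ b ∈ torU I := by
        rw [ht, SetLike.mem_coe, mem_powIdeal_iff]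
        exact ⟨1, (mul_one _).symm⟩
      obtain ⟨z, hz⟩ := (mem_torU_iff h).1 hy
      exact (I.add_mem_iff_left (I.mul_mem_right _ hu2)).1 hz
    · exact hu2

end SelfAnnihilating

end Isodual

end U3Code

open U3Code

/-! ### The classification by types. -/

theorem mainTheorem9 (p m n s : ℕ) (hp : p.Prime) (hm : 0 < m) (hn : 0 < n) (hs : 0 < s)
    (F : Type*) [Field F] [Fintype F] (hF : Fintype.card F = p ^ m)
    (α₀ : F) (hα₀ : α₀ ≠ 0) (hirr : Irreducible (X ^ n - C α₀ : F[X]))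
    (Eqv : Submodule (ChainRing F) (Fin (n * p ^ s) → ChainRing F) →
      Submodule (ChainRing F) (Fin (n * p ^ s) → ChainRing F) → Prop)
    (hEqv : Eqv = MonomiallyEquivalent ∨ Eqv = LinearlyIsomorphic)
    (f u : ConstaRing F (n * p ^ s) (alpha (p ^ s) α₀))
    (hf : f = cls _ _ (X ^ n - C α₀)) (hu : u = uu _ _) :
    (∀ I : Ideal (ConstaRing F (n * p ^ s) (alpha (p ^ s) α₀)), IsTypeI I → ¬ IsIsodual Eqv I) ∧
    ((∃ I : Ideal (ConstaRing F (n * p ^ s) (alpha (p ^ s) α₀)), IsTypeII I ∧ IsIsodual Eqv I) ↔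
      p = 2) ∧
    (p = 2 → ∀ I : Ideal (ConstaRing F (n * p ^ s) (alpha (p ^ s) α₀)),
      (IsTypeII I ∧ IsIsodual Eqv I) ↔ I = Ideal.span {u * f ^ 2 ^ (s - 1), u ^ 2}) ∧
    ((∃ I : Ideal (ConstaRing F (n * p ^ s) (alpha (p ^ s) α₀)), IsTypeIII I ∧ IsIsodual Eqv I) ↔
      p = 2) ∧
    (p = 2 → ∀ (a t₂ : ℕ) (D₂ : ConstaRing F (n * p ^ s) (alpha (p ^ s) α₀)),
      2 ^ (s - 1) ≤ a → a < 2 ^ s →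
      (D₂ = 0 ∨ (t₂ < 2 ^ s - a ∧ IsUnit D₂ ∧
        ∃ Q : ℕ → F[X], (∀ l, (Q l).degree < n) ∧
          D₂ = ∑ l ∈ Finset.range (2 ^ s - a - t₂), cls _ _ (Q l) * f ^ l)) →
      ∀ I : Ideal (ConstaRing F (n * p ^ s) (alpha (p ^ s) α₀)),
        I = Ideal.span {f ^ a + u ^ 2 * f ^ t₂ * D₂, u * f ^ 2 ^ (s - 1), u ^ 2 * f ^ (2 ^ s - a)} →
        IsTypeIII I ∧ IsIsodual Eqv I ∧ I.annihilator = I) := by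

  have : Fact p.Prime := ⟨hp⟩
  have hchar : CharP F p := charP_of_card_eq_prime_pow hF
  have hn' : n ≠ 0 := hn.ne'
  have hq : p ^ s ≠ 0 := pow_ne_zero _ hp.ne_zero
  have hN := mul_ne_zero hn' hq
  have h : binom n α₀ ^ p ^ s = X ^ (n * p ^ s) - C (α₀ ^ p ^ s) := by
    rw [binom, sub_pow_char_pow, ← pow_mul, ← C_pow]
  have hp2 : ∀ b, 2 * b = p ^ s → p = 2 := fun b hb =>
    ((Nat.prime_dvd_prime_iff_eq Nat.prime_two hp).1
      (Nat.prime_two.dvd_of_dvd_pow ⟨b, hb.symm⟩)).symm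
  have hexp : ∀ {I : Ideal (ConstaRing F (n * p ^ s) (alpha (p ^ s) α₀))} {a b c : ℕ},
      HasExponents I a b c → IsIsodual Eqv I → a + c = p ^ s ∧ 2 * b = p ^ s :=
    fun hI hiso => hI.add_eq_of_isomorphic hn' hq h (isomorphic_of_eqv hEqv hiso)
  have hhalf : p = 2 → 2 * 2 ^ (s - 1) = p ^ s := by
    rintro rfl
    exact mul_pow_sub_one hs.ne' 2
  have hgood : p = 2 → ∀ (a : ℕ) (t : ConstaRing F (n * p ^ s) (alpha (p ^ s) α₀)),
      2 ^ (s - 1) ≤ a → a ≤ p ^ s → ∀ I,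
      I = Ideal.span {f ^ a + u ^ 2 * t, u * f ^ 2 ^ (s - 1), u ^ 2 * f ^ (p ^ s - a)} →
      HasExponents I a (2 ^ (s - 1)) (p ^ s - a) ∧ IsIsodual Eqv I ∧ I.annihilator = I := by
    intro h2 a t hea haq I hI
    have : CharP F 2 := h2 ▸ hchar
    obtain ⟨h1, h2⟩ := annihilator_eq_and_hasExponents hn' hq h (hhalf h2) hea haq hf hu hI
    exact ⟨h2, isIsodual_of_annihilator_eq hN hEqv h1, h1⟩
  have htypeII : p = 2 → ∀ I : Ideal (ConstaRing F (n * p ^ s) (alpha (p ^ s) α₀)),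
      (IsTypeII I ∧ IsIsodual Eqv I) ↔ I = Ideal.span {u * f ^ 2 ^ (s - 1), u ^ 2} := by
    intro h2 I
    have hh := hhalf h2
    constructor
    · rintro ⟨⟨b, c, -, hI⟩, hiso⟩
      obtain ⟨hac, hb⟩ := hexp hI hiso
      obtain rfl : c = 0 := by omega
      obtain rfl : b = 2 ^ (s - 1) := by omega
      rw [hI.eq_span hn' hq h, hf, hu]
    · intro hI
      have hfq : f ^ p ^ s = 0 := by
        rw [hf, ← incl_mk_binom h, ← map_pow, mk_binom_pow_eq_zero, map_zero]
      -- At `a = q`, `t = 0` the first generator is `f^q = 0` and the third is `u²`.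
      obtain ⟨h1, h3, -⟩ := hgood h2 (p ^ s) 0 (by omega) le_rfl I (by
        rw [hI, hfq, mul_zero, add_zero, Nat.sub_self, pow_zero, mul_one, Ideal.span_insert_zero])
      rw [Nat.sub_self] at h1
      exact ⟨⟨_, _, by have := Nat.pos_of_ne_zero hq; omega, h1⟩, h3⟩
  refine ⟨?_, ⟨?_, ?_⟩, htypeII, ⟨?_, ?_⟩, ?_⟩
  · rintro I ⟨c, hI⟩ hiso
    have := (hexp hI hiso).2
    omega
  · rintro ⟨I, ⟨b, c, -, hI⟩, hiso⟩
    exact hp2 b (hexp hI hiso).2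
  · exact fun h2 => ⟨_, (htypeII h2 _).2 rfl⟩
  · rintro ⟨I, ⟨a, b, c, -, hI⟩, hiso⟩
    exact hp2 b (hexp hI hiso).2
  · intro h2
    have hh := hhalf h2
    have hpos := Nat.pos_of_ne_zero hq
    obtain ⟨h1, h3, -⟩ := hgood h2 (2 ^ (s - 1)) 0 le_rfl (by omega) _ rfl
    exact ⟨_, ⟨_, _, _, by omega, h1⟩, h3⟩
  · intro h2 a t₂ D₂ hea haq _ I hI
    have hps : 2 ^ s - a = p ^ s - a := by rw [h2]
    obtain ⟨h1, h3⟩ := hgood h2 a (f ^ t₂ * D₂) hea (by omega) I (by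
      rw [hI, hps, mul_assoc])
    exact ⟨⟨_, _, _, by omega, h1⟩, h3⟩
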